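/- Theorem 1.4. Model. For a nonempty set $S\subseteq[N]=\{1,\dots,N\}$ let $|S\rangle=|S|^{-1/2}\sum_{i\in S}|i\rangle\in\mathbb{C}^N$ and let $\mathcal R_S=\mathbb 1-2|S\rangle\langle S|$ be the reflection about $|S\rangle$. A quantum algorithm using $R_1$ copies of $|S\rangle$ and $R_2$ reflections about $|S\rangle$ works on $(\mathbb{C}^N)^{\otimes R_1}\otimes\mathbb{C}^N\otimes\mathcal W$ with $\mathcal W$ a finite-dimensional workspace. It starts in $|S\rangle^{\otimes R_1}\otimes|\mathrm{init}\rangle$, where $|\mathrm{init}\rangle$ is a fixed computational basis state; it applies $R_2+1$ unitaries, with $\mathcal R_S$ applied to the $\mathbb{C}^N$ register (and the identity to the other registers) between any two consecutive ones; then it measures in the computational basis and accepts if the outcome lies in a fixed set. The unitaries, $|\mathrm{init}\rangle$, the accepting set, $R_1$ and $R_2$ may depend on $N$, $w$ and the allowed error, but not on $S$; the algorithm has no other access to $S$. Statement. For every error bound $\varepsilon>0$ there is a constant $C>0$ such that for all integers $N\ge 1$ and $w\ge 1$ there is such an algorithm with $$R_1+R_2\;\le\; C\cdot\min\left\{w^{1/3},\sqrt{N/w}\right\}$$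 that solves $\mathsf{ApxCount}_{N,w}$ with error at most $\varepsilon$: for every nonempty $S\subseteq[N]$, it accepts with probability at least $1-\varepsilon$ if $|S|\ge 2w$, and with probability at most $\varepsilon$ if $|S|\le w$. -/

import Mathlib

open scoped Kronecker

noncomputable section

/-- The uniform superposition `|S⟩ = |S|^{-1/2} ∑_{i ∈ S} |i⟩` in `ℂ^N`, where the computational
basis of `ℂ^N` is indexed by `Fin N` (playing the role of `{1, …, N}`). -/
def uniformKet {N : ℕ} (S : Finset (Fin N)) : Fin N → ℂ :=
  fun i => if i ∈ S then ((1 / Real.sqrt (S.card : ℝ) : ℝ) : ℂ) else 0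

/-- The reflection `R_S = 1 - 2 |S⟩⟨S|` on `ℂ^N`. -/
def reflectionAbout {N : ℕ} (S : Finset (Fin N)) : Matrix (Fin N) (Fin N) ℂ :=
  1 - (2 : ℂ) • Matrix.vecMulVec (uniformKet S) (star (uniformKet S))

/-- A quantum algorithm, for sets `S ⊆ [N]`, that receives copies of `|S⟩` and may apply the
reflection about `|S⟩`, but has no other access to `S`.

Its Hilbert space is `(ℂ^N)^{⊗ copies} ⊗ ℂ^N ⊗ ℂ^work`: the registers that initially hold the copies
of `|S⟩`, the register on which the reflection acts, and a finite-dimensional workspace. The last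
two start in the computational basis state `init`. The algorithm applies `unitary 0`, then
the reflection, then `unitary 1`, …, then the reflection, then `unitary reflections`; finally
it measures in the computational basis and accepts if the outcome lies in `accept`. None of these
data depends on `S`. Only `unitary 0, …, unitary reflections` are ever used. -/
structure SampleReflectAlg (N : ℕ) where
  /-- number of copies of `|S⟩` consumed -/
  copies : ℕ
  /-- number of applications of the reflection about `|S⟩` -/
  reflections : ℕ
  /-- basis labels of the workspace -/
  work : Type
  [fintypeWork : Fintype work]
  [decEqWork : DecidableEq work]
  /-- initial basis state of the reflection register and the workspace -/
  init : Fin N × work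
  /-- the unitaries, independent of `S`, applied between the reflections -/
  unitary : ℕ → Matrix.unitaryGroup ((Fin copies → Fin N) × (Fin N × work)) ℂ
  /-- the accepting measurement outcomes -/
  accept : Finset ((Fin copies → Fin N) × (Fin N × work))

namespace SampleReflectAlg

attribute [instance] SampleReflectAlg.fintypeWork SampleReflectAlg.decEqWork

variable {N : ℕ}

/-- Computational basis labels of the whole Hilbert space. -/
abbrev Basis (Q : SampleReflectAlg N) : Type := (Fin Q.copies → Fin N) × (Fin N × Q.work)

/-- The initial state `|S⟩^{⊗ copies} ⊗ |init⟩`. -/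
def initialState (Q : SampleReflectAlg N) (S : Finset (Fin N)) : Q.Basis → ℂ :=
  fun b => (∏ j, uniformKet S (b.1 j)) * (if b.2 = Q.init then 1 else 0)

/-- The reflection about `|S⟩` on its register, tensored with the identity elsewhere. -/
def reflectionOp (Q : SampleReflectAlg N) (S : Finset (Fin N)) : Matrix Q.Basis Q.Basis ℂ :=
  (1 : Matrix (Fin Q.copies → Fin N) (Fin Q.copies → Fin N) ℂ) ⊗ₖ
    (reflectionAbout S ⊗ₖ (1 : Matrix Q.work Q.work ℂ))

/-- The state after `t` reflections (and the `t + 1` unitaries around them). -/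
def stateAfter (Q : SampleReflectAlg N) (S : Finset (Fin N)) : ℕ → Q.Basis → ℂ
  | 0 => (Q.unitary 0 : Matrix Q.Basis Q.Basis ℂ).mulVec (Q.initialState S)
  | t + 1 => (Q.unitary (t + 1) : Matrix Q.Basis Q.Basis ℂ).mulVec
      ((Q.reflectionOp S).mulVec (Q.stateAfter S t))

/-- The probability that the algorithm accepts on `S`. -/
def acceptProb (Q : SampleReflectAlg N) (S : Finset (Fin N)) : ℝ :=
  ∑ b ∈ Q.accept, ‖Q.stateAfter S Q.reflections b‖ ^ 2

/-- The algorithm decides, with error probability at most `ε`, whether a nonempty set `S ⊆ [N]`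
has `|S| ≥ 2w` (accept) or `|S| ≤ w` (reject), promised that one of these holds. -/
def SolvesApxCount (Q : SampleReflectAlg N) (w : ℕ) (ε : ℝ) : Prop :=
  ∀ S : Finset (Fin N), S.Nonempty →
    (2 * w ≤ S.card → 1 - ε ≤ Q.acceptProb S) ∧ (S.card ≤ w → Q.acceptProb S ≤ ε)

end SampleReflectAlg

end

noncomputable section

/-! ### Unitary matrices acting on coordinate vectors -/

/-! The size of `S` is read off from an overlap `p = ⟨S|P|S⟩` with a known projection `P`. Two
choices of `P` give the two terms of the minimum, and each only requires deciding between `p ≤ p₀`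
and `p ≥ 2p₀` with `O(1/√p₀)` reflections.

If `P` projects onto the uniform superposition over `[N]`, then `p = |S|/N` and `p₀ = w/N`, at cost
`√(N/w)` (`exists_solves_amplitude_estimation`). If `P` projects onto the span of `r` distinct
samples from `S`, then `p = r/|S|` and `p₀ = r/(2w)`, at cost `r + √(w/r)`; `r ≈ w^{1/3}` balances
the two terms, and repetitions among the samples are rare when `|S| ≥ 2w`
(`exists_solves_sampling`).

The decision (`exists_phase_discriminator`) replaces the spectral analysis of the product of two
reflections by a three-term recurrence. The orbit `w_s` of `|S⟩` under `-(1 - 2P)R_S` satisfies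
`w_{s+2} + w_s = 2(1 - 2p) w_{s+1}` (`rotationOrbit_recurrence`). Hence a control register in a
smooth superposition of step counts is almost an eigenvector of half the adjacency matrix of a path,
with eigenvalue `1 - 2p` (`pathMatrix_window_defect`). Measuring the control in the eigenbasis of
that matrix therefore yields a value near `1 - 2p`, by a second-moment bound. -/

theorem Matrix.unitaryGroup.sum_norm_sq_mulVec {ι : Type*} [Fintype ι] [DecidableEq ι]
    (U : Matrix.unitaryGroup ι ℂ) (f : ι → ℂ) :
    ∑ i, ‖((U : Matrix ι ι ℂ).mulVec f) i‖ ^ 2 = ∑ i, ‖f i‖ ^ 2 := by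
  have key : ∀ g : ι → ℂ, ((∑ i, ‖g i‖ ^ 2 : ℝ) : ℂ) = dotProduct (star g) g := by
    intro g
    simp only [dotProduct, Pi.star_apply, Complex.ofReal_sum, Complex.ofReal_pow]
    exact Finset.sum_congr rfl fun i _ => (Complex.conj_mul' (g i)).symm
  have h : star (U : Matrix ι ι ℂ) * (U : Matrix ι ι ℂ) = 1 :=
    Matrix.mem_unitaryGroup_iff'.1 U.2
  apply Complex.ofReal_injective
  rw [key, key, Matrix.star_mulVec, Matrix.dotProduct_mulVec, Matrix.vecMul_vecMul,
    ← Matrix.star_eq_conjTranspose, h, Matrix.vecMul_one]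

/-- A unit vector extends to an orthonormal basis. This supplies the unitary that prepares the
window state of the control register. -/
theorem Matrix.unitaryGroup.exists_col_eq {ι : Type*} [Fintype ι] [DecidableEq ι]
    (i₀ : ι) (a : ι → ℂ) (ha : ∑ i, ‖a i‖ ^ 2 = 1) :
    ∃ U : Matrix.unitaryGroup ι ℂ, ∀ i, (U : Matrix ι ι ℂ) i i₀ = a i := by
  have hv : Orthonormal ℂ (({i₀} : Set ι).domRestrict
      (fun _ : ι => (WithLp.toLp 2 a : EuclideanSpace ℂ ι))) := by
    rw [orthonormal_subsingleton_iff]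
    intro i
    simp [EuclideanSpace.norm_eq, ha]
  obtain ⟨b, hb⟩ := hv.exists_orthonormalBasis_extension_of_card_eq (by simp)
  refine ⟨⟨(EuclideanSpace.basisFun ι ℂ).toBasis.toMatrix b,
    OrthonormalBasis.toMatrix_orthonormalBasis_mem_unitary _ _⟩, fun i => ?_⟩
  simp [Module.Basis.toMatrix_apply, hb i₀ rfl]

theorem Matrix.IsHermitian.exists_unitary_diagonalizing {ι : Type*} [Fintype ι] [DecidableEq ι]
    {A : Matrix ι ι ℂ} (hA : A.IsHermitian) :
    ∃ (F : Matrix.unitaryGroup ι ℂ) (l : ι → ℝ), ∀ (f : ι → ℂ) (k : ι),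
      ((F : Matrix ι ι ℂ).mulVec (A.mulVec f)) k = l k * ((F : Matrix ι ι ℂ).mulVec f) k := by
  refine ⟨star hA.eigenvectorUnitary, hA.eigenvalues, fun f k => ?_⟩
  set V := hA.eigenvectorUnitary with hV
  have hs : A = (V : Matrix ι ι ℂ) * Matrix.diagonal (RCLike.ofReal ∘ hA.eigenvalues) *
      star (V : Matrix ι ι ℂ) := by
    have := hA.spectral_theorem
    rwa [Unitary.conjStarAlgAut_apply] at this
  have h : star (V : Matrix ι ι ℂ) * (V : Matrix ι ι ℂ) = 1 := Matrix.mem_unitaryGroup_iff'.1 V.2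
  have h2 : star (V : Matrix ι ι ℂ) * A =
      Matrix.diagonal (RCLike.ofReal ∘ hA.eigenvalues) * star (V : Matrix ι ι ℂ) := by
    conv_lhs => rw [hs]
    rw [← mul_assoc, ← mul_assoc, h, one_mul]
  rw [Matrix.mulVec_mulVec, Unitary.coe_star, h2, ← Matrix.mulVec_mulVec, Matrix.mulVec_diagonal]
  rfl

/-! ### The path matrix and the parabolic window -/

/-- Half the adjacency matrix of the path on `m` vertices. -/
def pathMatrix (m : ℕ) : Matrix (Fin m) (Fin m) ℂ := fun s t =>
  (if (s : ℕ) + 1 = t then 1 / 2 else 0) + (if (t : ℕ) + 1 = s then 1 / 2 else 0)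

theorem pathMatrix_isHermitian (m : ℕ) : (pathMatrix m).IsHermitian := by
  ext s t
  simp only [Matrix.conjTranspose_apply, pathMatrix, star_add]
  split_ifs <;> simp

/-- Vertex `s` carries `h (s + 1)`, so the missing neighbours of the two end vertices would carry `h
0` and `h (m + 1)`. Since these vanish, the ends of the path leave no boundary term. -/
theorem pathMatrix_mulVec {m : ℕ} (h : ℕ → ℂ) (h0 : h 0 = 0) (hm : h (m + 1) = 0) (t : Fin m) :
    (pathMatrix m).mulVec (fun s => h (s + 1)) t = (h (t + 2) + h t) / 2 := by
  obtain ⟨t, ht⟩ := t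
  simp only [Matrix.mulVec, dotProduct, pathMatrix, add_mul, ite_mul, zero_mul]
  rw [Fin.sum_univ_eq_sum_range (fun s => (if t + 1 = s then 1 / 2 * h (s + 1) else 0) +
    if s + 1 = t then 1 / 2 * h (s + 1) else 0) m, Finset.sum_add_distrib, Finset.sum_ite_eq]
  have h1 : (if t + 1 ∈ Finset.range m then 1 / 2 * h (t + 1 + 1) else 0) = h (t + 2) / 2 := by
    split_ifs with hh
    · ring_nf
    · have : t + 2 = m + 1 := by simp at hh; omega
      rw [this, hm]; simp
  have h2 : (∑ s ∈ Finset.range m, if s + 1 = t then 1 / 2 * h (s + 1) else 0) = h t / 2 := by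
    rcases t with _ | t
    · simp [h0]
    · simp only [Nat.add_right_cancel_iff]
      rw [Finset.sum_ite_eq', if_pos (by simp; omega)]
      ring
  rw [h1, h2]; ring

theorem sum_parabola (M : ℝ) (m : ℕ) :
    ∑ t ∈ Finset.range m, ((t : ℝ) + 1) * (M - t) =
      m * (m + 1) * (3 * M - 2 * m + 2) / 6 := by
  induction m with
  | zero => simp
  | succ k ih => rw [Finset.sum_range_succ, ih]; push_cast; ring

theorem sum_parabola_sq_ge (m : ℕ) :
    (m : ℝ) ^ 5 / 36 ≤ ∑ t : Fin m, (((t : ℕ) + 1 : ℝ) * (m - (t : ℕ))) ^ 2 := by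
  rcases Nat.eq_zero_or_pos m with rfl | hm
  · simp
  have hm' : (0 : ℝ) < m := by exact_mod_cast hm
  -- Cauchy–Schwarz against the constant function reduces the fourth-degree sum to the cubic
  -- `sum_parabola`.
  have h := sq_sum_le_card_mul_sum_sq (s := Finset.univ)
    (f := fun t : Fin m => ((t : ℕ) + 1 : ℝ) * (m - (t : ℕ)))
  rw [Fin.sum_univ_eq_sum_range (fun t => ((t : ℝ) + 1) * (m - t)) m, sum_parabola,
    Finset.card_univ, Fintype.card_fin] at h
  refine le_of_mul_le_mul_left (le_trans ?_ h) hm'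
  have h3 : (m : ℝ) ^ 3 / 6 ≤ (m : ℝ) * (m + 1) * (3 * m - 2 * m + 2) / 6 := by nlinarith
  calc (m : ℝ) * ((m : ℝ) ^ 5 / 36) = ((m : ℝ) ^ 3 / 6) ^ 2 := by ring
    _ ≤ _ := by gcongr

/-- For sequences of vectors rotating with phase `φ`, `cos φ = 1 - 2 p`, a superposition of the
vectors with the parabolic window is nearly an eigenvector of the path matrix. -/
theorem pathMatrix_window_defect {ι : Type*} [Fintype ι] (m : ℕ) (w : ℕ → ι → ℂ) (p : ℝ)
    (hp0 : 0 ≤ p) (hp1 : p ≤ 1) (hw : ∀ s, ∑ i, ‖w s i‖ ^ 2 = 1)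
    (hrec : ∀ s i, w (s + 2) i + w s i = 2 * (1 - 2 * p) * w (s + 1) i) :
    ∑ t : Fin m, ∑ i,
      ‖(pathMatrix m).mulVec (fun s => (((s : ℕ) + 1 : ℝ) * (m - (s : ℕ)) : ℝ) * w (s + 1) i) t
        - (1 - 2 * p) * ((((t : ℕ) + 1 : ℝ) * (m - (t : ℕ)) : ℝ) * w (t + 1) i)‖ ^ 2
      ≤ m * (2 + 8 * (m : ℝ) ^ 2 * p) := by
  -- By the parallelogram law and the recurrence, the sum equals `4 - 4(1 - 2p)² = 16p(1 - p)`.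
  have hdiff : ∀ s, ∑ i, ‖w (s + 2) i - w s i‖ ^ 2 ≤ 16 * p := by
    intro s
    have hpar : ∀ i, ‖w (s + 2) i - w s i‖ ^ 2 = 2 * ‖w (s + 2) i‖ ^ 2 + 2 * ‖w s i‖ ^ 2
        - 4 * (1 - 2 * p) ^ 2 * ‖w (s + 1) i‖ ^ 2 := by
      intro i
      have h1 := parallelogram_law_with_norm ℝ (w (s + 2) i) (w s i)
      have h2 : ‖w (s + 2) i + w s i‖ ^ 2 = 4 * (1 - 2 * p) ^ 2 * ‖w (s + 1) i‖ ^ 2 := by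
        rw [hrec, norm_mul, mul_pow]
        congr 1
        rw [show (2 * (1 - 2 * p) : ℂ) = ((2 * (1 - 2 * p) : ℝ) : ℂ) by push_cast; ring,
          Complex.norm_real, Real.norm_eq_abs, sq_abs]
        ring
      nlinarith
    simp only [hpar, Finset.sum_sub_distrib, Finset.sum_add_distrib, ← Finset.mul_sum, hw]
    nlinarith
  have hpt : ∀ (t : Fin m) (i : ι),
      ‖(pathMatrix m).mulVec (fun s => (((s : ℕ) + 1 : ℝ) * (m - (s : ℕ)) : ℝ) * w (s + 1) i) t
        - (1 - 2 * p) * ((((t : ℕ) + 1 : ℝ) * (m - (t : ℕ)) : ℝ) * w (t + 1) i)‖ ^ 2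
      ≤ 2 * ‖w (t + 1) i‖ ^ 2 + (m : ℝ) ^ 2 / 2 * ‖w (t + 2) i - w t i‖ ^ 2 := by
    intro t i
    have h1 := pathMatrix_mulVec (m := m)
      (fun s => (((s : ℝ) * (m + 1 - s) : ℝ) : ℂ) * w s i) (by simp) (by simp) t
    have h2 : (fun s : Fin m => (((s : ℕ) + 1 : ℝ) * (m - (s : ℕ)) : ℝ) * w (s + 1) i)
        = fun s : Fin m => (((((s : ℕ) + 1 : ℕ) : ℝ) * (m + 1 - ((s : ℕ) + 1 : ℕ)) : ℝ) : ℂ)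
          * w (s + 1) i := by
      ext s; push_cast; ring
    rw [h2, h1]
    -- The parabola has constant second difference `-2`, giving the first term. Its centred slope
    -- `(m - 1 - 2t)/2`, at most `m/2` in modulus, multiplies the centred difference of `w`.
    have h3 : ((((((t : ℕ) + 2 : ℕ) : ℝ) * (m + 1 - ((t : ℕ) + 2 : ℕ)) : ℝ) : ℂ) * w (t + 2) i
        + ((((t : ℕ) : ℝ) * (m + 1 - (t : ℕ)) : ℝ) : ℂ) * w t i) / 2
        - (1 - 2 * p) * ((((t : ℕ) + 1 : ℝ) * (m - (t : ℕ)) : ℝ) * w (t + 1) i)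
        = -((1 - 2 * p : ℝ) : ℂ) * w (t + 1) i
          + (((m - 1 - 2 * (t : ℕ)) / 2 : ℝ) : ℂ) * (w (t + 2) i - w t i) := by
      have := hrec t i
      push_cast
      linear_combination (((t : ℕ) + 1 : ℂ) * (m - (t : ℕ)) / 2 - 1 / 2) * this
    rw [h3]
    have ht : ((t : ℕ) : ℝ) + 1 ≤ m := by exact_mod_cast t.2
    have ht0 : (0 : ℝ) ≤ (t : ℕ) := by positivity
    calc _ ≤ (‖-((1 - 2 * p : ℝ) : ℂ) * w (t + 1) i‖
            + ‖(((m - 1 - 2 * (t : ℕ)) / 2 : ℝ) : ℂ) * (w (t + 2) i - w t i)‖) ^ 2 := by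
          gcongr; exact norm_add_le _ _
      _ ≤ 2 * (‖-((1 - 2 * p : ℝ) : ℂ) * w (t + 1) i‖ ^ 2
            + ‖(((m - 1 - 2 * (t : ℕ)) / 2 : ℝ) : ℂ) * (w (t + 2) i - w t i)‖ ^ 2) :=
          add_sq_le
      _ ≤ _ := by
          rw [norm_mul, norm_mul, norm_neg, Complex.norm_real, Complex.norm_real, mul_pow, mul_pow,
            Real.norm_eq_abs, Real.norm_eq_abs, sq_abs, sq_abs]
          have e1 : (1 - 2 * p) ^ 2 * ‖w (t + 1) i‖ ^ 2 ≤ 1 * ‖w (t + 1) i‖ ^ 2 := by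
            gcongr; nlinarith
          have e2 : (((m : ℝ) - 1 - 2 * (t : ℕ)) / 2) ^ 2 * ‖w (t + 2) i - w t i‖ ^ 2
              ≤ (m : ℝ) ^ 2 / 4 * ‖w (t + 2) i - w t i‖ ^ 2 := by
            gcongr; nlinarith
          linarith
  calc _ ≤ ∑ t : Fin m, ∑ i,
        (2 * ‖w (t + 1) i‖ ^ 2 + (m : ℝ) ^ 2 / 2 * ‖w (t + 2) i - w t i‖ ^ 2) :=
        Finset.sum_le_sum fun t _ => Finset.sum_le_sum fun i _ => hpt t i
    _ ≤ ∑ t : Fin m, (2 + 8 * (m : ℝ) ^ 2 * p) := by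
        refine Finset.sum_le_sum fun t _ => ?_
        rw [Finset.sum_add_distrib, ← Finset.mul_sum, ← Finset.mul_sum, hw]
        have := mul_le_mul_of_nonneg_left (hdiff t) (by positivity : 0 ≤ (m : ℝ) ^ 2 / 2)
        linarith
    _ = _ := by rw [Finset.sum_const, Finset.card_univ, Fintype.card_fin, nsmul_eq_mul]

/-- Chebyshev's inequality for the outcome of a measurement diagonalizing `A`. -/
theorem sum_norm_sq_le_of_far_from_eigenvalue {ι κ : Type*} [Fintype ι] [DecidableEq ι] [Fintype κ]
    {A : Matrix ι ι ℂ} {F : Matrix.unitaryGroup ι ℂ} {l : ι → ℝ}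
    (hF : ∀ (f : ι → ℂ) (k : ι),
      ((F : Matrix ι ι ℂ).mulVec (A.mulVec f)) k = l k * ((F : Matrix ι ι ℂ).mulVec f) k)
    (f : κ → ι → ℂ) (c E δ : ℝ) (hδ : 0 < δ)
    (hE : ∑ t, ∑ i, ‖A.mulVec (f i) t - c * f i t‖ ^ 2 ≤ E)
    (bad : Finset ι) (hbad : ∀ k ∈ bad, δ ≤ |l k - c|) :
    ∑ k ∈ bad, ∑ i, ‖((F : Matrix ι ι ℂ).mulVec (f i)) k‖ ^ 2 ≤ E / δ ^ 2 := by
  rw [le_div_iff₀ (by positivity), Finset.sum_mul]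
  refine le_trans ?_ hE
  -- In the diagonalizing basis, `A - c` multiplies coordinate `k` by `l k - c`, so each bad
  -- coordinate gains a factor of at least `δ²`.
  calc _ ≤ ∑ k ∈ bad, ∑ i, ‖((F : Matrix ι ι ℂ).mulVec (A.mulVec (f i) - (c : ℂ) • f i)) k‖ ^ 2 := by
        refine Finset.sum_le_sum fun k hk => ?_
        rw [Finset.sum_mul]
        refine Finset.sum_le_sum fun i _ => ?_
        rw [Matrix.mulVec_sub, Matrix.mulVec_smul, Pi.sub_apply, hF, Pi.smul_apply, smul_eq_mul,
          ← sub_mul, norm_mul, mul_pow, ← Complex.ofReal_sub, Complex.norm_real, Real.norm_eq_abs,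
          mul_comm]
        have := hbad k hk
        gcongr
    _ ≤ ∑ k, ∑ i, ‖((F : Matrix ι ι ℂ).mulVec (A.mulVec (f i) - (c : ℂ) • f i)) k‖ ^ 2 :=
        Finset.sum_le_sum_of_subset_of_nonneg (Finset.subset_univ _) fun _ _ _ => by positivity
    _ = _ := by
        rw [Finset.sum_comm]
        simp only [Matrix.unitaryGroup.sum_norm_sq_mulVec]
        rw [Finset.sum_comm]
        rfl

/-- With `m ≈ K/√p₀` control values, the window has squared norm at least `m⁵/36` and squared defect
at most `m(2 + 8m²p)`. After normalization the mean squared deviation from `1 - 2p` is at most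
`72/m⁴ + 288p/m²`, which is `O(1/K²)` relative to the squared gap in both cases. The amplitudes `a`,
the measurement `F` and the set `G` do not depend on `w` or `p`, so the algorithm can use them
without knowing `S`. -/
theorem exists_phase_discriminator (η : ℝ) (hη : 0 < η) :
    ∃ K : ℝ, 0 < K ∧ ∀ p₀ : ℝ, 0 < p₀ → p₀ ≤ 1 → ∃ n : ℕ, (n : ℝ) ≤ K / √p₀ ∧
      ∃ (F : Matrix.unitaryGroup (Fin (n + 1)) ℂ) (a : Fin (n + 1) → ℂ) (G : Finset (Fin (n + 1))),
        ∑ t, ‖a t‖ ^ 2 = 1 ∧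
        ∀ {ι : Type} [Fintype ι] (w : ℕ → ι → ℂ) (p : ℝ), 0 ≤ p → p ≤ 1 →
          (∀ s, ∑ i, ‖w s i‖ ^ 2 = 1) →
          (∀ s i, w (s + 2) i + w s i = 2 * (1 - 2 * p) * w (s + 1) i) →
          (p ≤ p₀ → ∑ k ∈ Gᶜ, ∑ i, ‖(F : Matrix _ _ ℂ).mulVec (fun t => a t * w (t + 1) i) k‖ ^ 2
            ≤ η) ∧
          (2 * p₀ ≤ p → ∑ k ∈ G, ∑ i, ‖(F : Matrix _ _ ℂ).mulVec (fun t => a t * w (t + 1) i) k‖ ^ 2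
            ≤ η) := by
  -- The constant `648 = 4 · (18 + 144)` comes from the case `2p₀ ≤ p` with gap `p/2`; the other
  -- case needs only `72 + 288 = 360`.
  obtain ⟨K, hK1, hK⟩ : ∃ K : ℝ, 1 ≤ K ∧ 648 / η ≤ K ^ 2 := by
    refine ⟨max 1 (648 / η), le_max_left _ _, ?_⟩
    have h1 := le_max_left 1 (648 / η)
    have h2 := le_max_right 1 (648 / η)
    nlinarith
  have hK' : 648 / K ^ 2 ≤ η := by
    rw [div_le_iff₀ (by positivity)]
    rw [div_le_iff₀ hη] at hK
    linarith
  refine ⟨K + 1, by positivity, fun p₀ hp₀ hp₀1 => ⟨⌈K / √p₀⌉₊, ?_, ?_⟩⟩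
  · have hs : 0 < √p₀ := Real.sqrt_pos.2 hp₀
    have hs1 : √p₀ ≤ 1 := Real.sqrt_le_one.2 hp₀1
    have := (Nat.ceil_lt_add_one (show 0 ≤ K / √p₀ by positivity)).le
    rw [add_div]
    have h1 : 1 ≤ 1 / √p₀ := by rw [le_div_iff₀ hs]; linarith
    linarith
  set n := ⌈K / √p₀⌉₊ with hn
  set m := n + 1 with hm
  have hmK : 1 / (m : ℝ) ^ 2 ≤ p₀ / K ^ 2 := by
    have hs : 0 < √p₀ := Real.sqrt_pos.2 hp₀
    have h1 : K / √p₀ ≤ m := (Nat.le_ceil _).trans (by rw [hm]; push_cast; linarith)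
    have h2 : (K / √p₀) ^ 2 ≤ (m : ℝ) ^ 2 := by gcongr
    rw [div_pow, Real.sq_sqrt hp₀.le] at h2
    have h3 : p₀ / K ^ 2 = 1 / (K ^ 2 / p₀) := by rw [one_div_div]
    rw [h3]
    gcongr
  have hmpos : (0 : ℝ) < m := by rw [hm]; positivity
  obtain ⟨F, l, hF⟩ := (pathMatrix_isHermitian m).exists_unitary_diagonalizing
  set A : ℝ := ∑ t : Fin m, (((t : ℕ) + 1 : ℝ) * (m - (t : ℕ))) ^ 2 with hA
  have hA36 : (m : ℝ) ^ 5 / 36 ≤ A := sum_parabola_sq_ge m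
  have hApos : 0 < A := lt_of_lt_of_le (by positivity) hA36
  set b : ℝ := 1 / √A with hb
  have hbsq : b ^ 2 = 1 / A := by rw [hb, div_pow, Real.sq_sqrt hApos.le, one_pow]
  -- The cutoff `1 - 3p₀` is at distance at least `p₀` from `1 - 2p` when `p ≤ p₀`, and at least
  -- `p/2` when `p ≥ 2p₀`.
  refine ⟨F, fun t => (b * (((t : ℕ) + 1 : ℝ) * (m - (t : ℕ))) : ℝ),
    Finset.univ.filter fun k => 1 - 3 * p₀ ≤ l k, ?_, ?_⟩
  · simp only [Complex.norm_real, Real.norm_eq_abs, sq_abs, mul_pow b, ← Finset.mul_sum, hbsq]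
    rw [← hA]; field_simp
  intro ι _ w p hp hp1 hw hrec
  have hE : ∑ t : Fin m, ∑ i, ‖(pathMatrix m).mulVec
        (fun t => ((b * (((t : ℕ) + 1 : ℝ) * (m - (t : ℕ))) : ℝ) : ℂ) * w (t + 1) i) t
        - ((1 - 2 * p : ℝ) : ℂ) * (((b * (((t : ℕ) + 1 : ℝ) * (m - (t : ℕ))) : ℝ) : ℂ)
          * w (t + 1) i)‖ ^ 2 ≤ 72 * (p₀ / K ^ 2) ^ 2 + 288 * p * (p₀ / K ^ 2) := by
    have h := pathMatrix_window_defect m w p hp hp1 hw hrec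
    calc _ = b ^ 2 * _ := ?_
      _ ≤ b ^ 2 * _ := mul_le_mul_of_nonneg_left h (by positivity)
      _ ≤ 36 / (m : ℝ) ^ 5 * (m * (2 + 8 * (m : ℝ) ^ 2 * p)) := by
          gcongr
          rw [hbsq, one_div_le (by positivity) (by positivity), one_div_div]
          exact hA36
      _ = 72 * (1 / (m : ℝ) ^ 2) ^ 2 + 288 * p * (1 / (m : ℝ) ^ 2) := by field_simp; ring
      _ ≤ _ := by gcongr
    rw [Finset.mul_sum]
    refine Finset.sum_congr rfl fun t _ => ?_
    rw [Finset.mul_sum]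
    refine Finset.sum_congr rfl fun i _ => ?_
    have e : (fun t : Fin m => ((b * (((t : ℕ) + 1 : ℝ) * (m - (t : ℕ))) : ℝ) : ℂ) * w (t + 1) i)
        = (b : ℂ) • fun t : Fin m => (((((t : ℕ) + 1 : ℝ) * (m - (t : ℕ))) : ℝ) : ℂ)
          * w (t + 1) i := by
      ext t; simp only [Pi.smul_apply, smul_eq_mul]; push_cast; ring
    rw [e, Matrix.mulVec_smul, Pi.smul_apply, smul_eq_mul]
    rw [← sq_abs b, ← Real.norm_eq_abs, ← Complex.norm_real, ← mul_pow, ← norm_mul]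
    congr 2
    push_cast
    ring
  have hKK : p₀ / K ^ 2 ≤ p₀ := div_le_self hp₀.le (by nlinarith)
  have hK0 : 0 ≤ p₀ / K ^ 2 := by positivity
  constructor
  · intro hpp
    have h := sum_norm_sq_le_of_far_from_eigenvalue hF
      (fun i t => ((b * (((t : ℕ) + 1 : ℝ) * (m - (t : ℕ))) : ℝ) : ℂ) * w (t + 1) i)
      (1 - 2 * p) _ p₀ hp₀ hE (Finset.univ.filter fun k => 1 - 3 * p₀ ≤ l k)ᶜ
      (by
        intro k hk
        simp only [Finset.mem_compl, Finset.mem_filter, Finset.mem_univ, true_and, not_le] at hk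
        rw [le_abs]; right; linarith)
    refine h.trans (le_trans ?_ hK')
    rw [div_le_iff₀ (by positivity)]
    have e : 648 / K ^ 2 * p₀ ^ 2 = 648 * (p₀ / K ^ 2) * p₀ := by ring
    rw [e]
    nlinarith [mul_le_mul_of_nonneg_left hKK hK0, mul_le_mul_of_nonneg_left hpp hK0]
  · intro hpp
    have h := sum_norm_sq_le_of_far_from_eigenvalue hF
      (fun i t => ((b * (((t : ℕ) + 1 : ℝ) * (m - (t : ℕ))) : ℝ) : ℂ) * w (t + 1) i)
      (1 - 2 * p) _ (p / 2) (by linarith) hE (Finset.univ.filter fun k => 1 - 3 * p₀ ≤ l k)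
      (by
        intro k hk
        simp only [Finset.mem_filter, Finset.mem_univ, true_and] at hk
        rw [le_abs]; left; linarith)
    refine h.trans (le_trans ?_ hK')
    have hppos : 0 < p := by linarith
    rw [div_le_iff₀ (by positivity)]
    have h1 : 72 * (p₀ / K ^ 2) ^ 2 ≤ 72 * (p₀ / K ^ 2) * p₀ := by nlinarith
    have h2 : (p₀ / K ^ 2) * p₀ ≤ (1 / K ^ 2) * (p / 2) * (p / 2) := by
      rw [show (p₀ / K ^ 2) * p₀ = (1 / K ^ 2) * (p₀ * p₀) by ring, mul_assoc]
      gcongr <;> linarith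
    have h3 : p * (p₀ / K ^ 2) ≤ (1 / K ^ 2) * p * (p / 2) := by
      rw [show p * (p₀ / K ^ 2) = (1 / K ^ 2) * p * p₀ by ring]
      gcongr
      linarith
    have e : 648 / K ^ 2 * (p / 2) ^ 2 = 162 * ((1 / K ^ 2) * p * p) := by ring
    rw [e]
    nlinarith

/-! ### Reflections about projections -/

/-- The reflection `1 - 2 P` determined by a projection `P`. -/
def reflectionOf {ι : Type*} [Fintype ι] [DecidableEq ι] {P : Matrix ι ι ℂ}
    (hP : IsStarProjection P) : Matrix.unitaryGroup ι ℂ :=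
  ⟨1 - (2 : ℂ) • P, by
    rw [Matrix.mem_unitaryGroup_iff, star_sub, star_one, star_smul, hP.isSelfAdjoint.star_eq,
      sub_mul, mul_sub, mul_sub, one_mul, one_mul, mul_one, smul_mul_smul_comm,
      hP.isIdempotentElem.eq]
    ext i j
    simp
    ring⟩

theorem coe_reflectionOf {ι : Type*} [Fintype ι] [DecidableEq ι] {P : Matrix ι ι ℂ}
    (hP : IsStarProjection P) :
    (reflectionOf hP : Matrix ι ι ℂ) = 1 - (2 : ℂ) • P := rfl

theorem reflectionOf_mulVec {ι : Type*} [Fintype ι] [DecidableEq ι] {P : Matrix ι ι ℂ}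
    (hP : IsStarProjection P) (f : ι → ℂ) :
    (reflectionOf hP : Matrix ι ι ℂ).mulVec f = f - (2 : ℂ) • P.mulVec f := by
  rw [coe_reflectionOf, Matrix.sub_mulVec, Matrix.one_mulVec, Matrix.smul_mulVec]

theorem reflectionOf_mulVec_mulVec {ι : Type*} [Fintype ι] [DecidableEq ι] {P : Matrix ι ι ℂ}
    (hP : IsStarProjection P) (f : ι → ℂ) :
    (reflectionOf hP : Matrix ι ι ℂ).mulVec ((reflectionOf hP : Matrix ι ι ℂ).mulVec f) = f := by
  rw [reflectionOf_mulVec, reflectionOf_mulVec, Matrix.mulVec_sub, Matrix.mulVec_smul,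
    Matrix.mulVec_mulVec, hP.isIdempotentElem.eq]
  ext i
  simp
  ring

variable {N : ℕ}

theorem norm_sq_uniformKet (S : Finset (Fin N)) (i : Fin N) :
    ‖uniformKet S i‖ ^ 2 = if i ∈ S then 1 / (S.card : ℝ) else 0 := by
  unfold uniformKet
  split_ifs
  · rw [Complex.norm_real, Real.norm_eq_abs, sq_abs, div_pow, Real.sq_sqrt (by positivity), one_pow]
  · simp

theorem star_uniformKet (S : Finset (Fin N)) : star (uniformKet S) = uniformKet S := by
  ext i
  unfold uniformKet
  simp only [Pi.star_apply]
  split_ifs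
  · exact Complex.conj_ofReal _
  · simp

theorem sum_norm_sq_uniformKet {S : Finset (Fin N)} (hS : S.Nonempty) :
    ∑ i, ‖uniformKet S i‖ ^ 2 = 1 := by
  have : (S.card : ℝ) ≠ 0 := by exact_mod_cast hS.card_pos.ne'
  simp [norm_sq_uniformKet, this]

theorem dotProduct_uniformKet_self {S : Finset (Fin N)} (hS : S.Nonempty) :
    dotProduct (uniformKet S) (uniformKet S) = 1 := by
  have h : dotProduct (star (uniformKet S)) (uniformKet S)
      = ((∑ i, ‖uniformKet S i‖ ^ 2 : ℝ) : ℂ) := by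
    simp only [dotProduct, Pi.star_apply, Complex.ofReal_sum, Complex.ofReal_pow]
    exact Finset.sum_congr rfl fun i _ => Complex.conj_mul' _
  rw [star_uniformKet, sum_norm_sq_uniformKet hS] at h
  simpa using h

theorem isStarProjection_uniformKet {S : Finset (Fin N)} (hS : S.Nonempty) :
    IsStarProjection (Matrix.vecMulVec (uniformKet S) (star (uniformKet S))) := by
  refine ⟨?_, ?_⟩
  · rw [IsIdempotentElem, Matrix.vecMulVec_mul_vecMulVec, star_uniformKet,
      dotProduct_uniformKet_self hS, one_smul]
  · rw [IsSelfAdjoint, Matrix.star_eq_conjTranspose, Matrix.conjTranspose_vecMulVec, star_star]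

theorem reflectionAbout_eq {S : Finset (Fin N)} (hS : S.Nonempty) :
    reflectionAbout S = (reflectionOf (isStarProjection_uniformKet hS) : Matrix _ _ ℂ) := rfl

theorem reflectionAbout_mulVec (S : Finset (Fin N)) (f : Fin N → ℂ) :
    (reflectionAbout S).mulVec f = f - (2 * dotProduct (uniformKet S) f) • uniformKet S := by
  rw [reflectionAbout, Matrix.sub_mulVec, Matrix.one_mulVec, Matrix.smul_mulVec,
    Matrix.vecMulVec_mulVec, star_uniformKet]
  ext i
  simp
  ring

theorem reflectionAbout_mulVec_uniformKet {S : Finset (Fin N)} (hS : S.Nonempty) :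
    (reflectionAbout S).mulVec (uniformKet S) = -uniformKet S := by
  rw [reflectionAbout_mulVec, dotProduct_uniformKet_self hS]
  ext i
  simp
  ring

/-- The orbit of `|S⟩` under the rotation `-(1 - 2 P) R_S`, starting one step before `|S⟩`. -/
def rotationOrbit {P : Matrix (Fin N) (Fin N) ℂ} (hP : IsStarProjection P) (S : Finset (Fin N)) :
    ℕ → Fin N → ℂ
  | 0 => -(reflectionAbout S).mulVec ((reflectionOf hP : Matrix (Fin N) (Fin N) ℂ).mulVec (uniformKet S))
  | s + 1 => -(reflectionOf hP : Matrix (Fin N) (Fin N) ℂ).mulVec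
      ((reflectionAbout S).mulVec (rotationOrbit hP S s))

section rotationOrbit

variable {P : Matrix (Fin N) (Fin N) ℂ} (hP : IsStarProjection P) {S : Finset (Fin N)}

theorem rotationOrbit_one (hS : S.Nonempty) : rotationOrbit hP S 1 = uniformKet S := by
  rw [rotationOrbit, rotationOrbit, reflectionAbout_eq hS, Matrix.mulVec_neg, Matrix.mulVec_neg,
    neg_neg, reflectionOf_mulVec_mulVec, reflectionOf_mulVec_mulVec]

theorem sum_norm_sq_rotationOrbit (hS : S.Nonempty) (s : ℕ) : ∑ i, ‖rotationOrbit hP S s i‖ ^ 2 = 1 := by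
  induction s with
  | zero =>
    simp only [rotationOrbit, Pi.neg_apply, norm_neg, reflectionAbout_eq hS,
      Matrix.unitaryGroup.sum_norm_sq_mulVec, sum_norm_sq_uniformKet hS]
  | succ s ih =>
    simp only [rotationOrbit, Pi.neg_apply, norm_neg, reflectionAbout_eq hS,
      Matrix.unitaryGroup.sum_norm_sq_mulVec, ih]

/-- For `f = (1 - 2P)|S⟩`, the vectors at indices 2 and 0 are `f` and `-R_S f = -f + 2⟨S|f⟩|S⟩`,
with `⟨S|f⟩ = 1 - 2p`, so their sum is a multiple of `|S⟩`. Applying the linear map `-(1 - 2P)R_S`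
propagates the relation. -/
theorem rotationOrbit_recurrence (hS : S.Nonempty) {p : ℝ}
    (hp : dotProduct (uniformKet S) (P.mulVec (uniformKet S)) = p) (s : ℕ) :
    rotationOrbit hP S (s + 2) + rotationOrbit hP S s
      = (2 * (1 - 2 * p) : ℂ) • rotationOrbit hP S (s + 1) := by
  induction s with
  | zero =>
    have h2 : rotationOrbit hP S 2 =
        (reflectionOf hP : Matrix (Fin N) (Fin N) ℂ).mulVec (uniformKet S) := by
      rw [rotationOrbit, rotationOrbit_one hP hS, reflectionAbout_mulVec_uniformKet hS,
        Matrix.mulVec_neg, neg_neg]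
    rw [zero_add, zero_add, h2, rotationOrbit_one hP hS, rotationOrbit,
      reflectionAbout_mulVec, reflectionOf_mulVec, dotProduct_sub, dotProduct_smul, hp,
      dotProduct_uniformKet_self hS]
    module
  | succ s ih =>
    have := congrArg (fun f => -(reflectionOf hP : Matrix (Fin N) (Fin N) ℂ).mulVec
      ((reflectionAbout S).mulVec f)) ih
    simp only [Matrix.mulVec_add, Matrix.mulVec_smul, neg_add] at this
    simpa only [rotationOrbit, smul_neg] using this

end rotationOrbit

/-! ### Conditional unitaries -/

/-- The unitary that applies `V a` to the first factor when the second factor is in state `a`. -/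
def conditionalUnitary {B α β : Type*} [Fintype B] [DecidableEq B] [Fintype α] [DecidableEq α]
    [Fintype β] [DecidableEq β] (e : B ≃ β × α) (V : α → Matrix.unitaryGroup β ℂ) :
    Matrix.unitaryGroup B ℂ :=
  ⟨(Matrix.blockDiagonal fun a => (V a : Matrix β β ℂ)).submatrix e e, by
    rw [Matrix.mem_unitaryGroup_iff, Matrix.star_eq_conjTranspose, Matrix.conjTranspose_submatrix,
      Matrix.submatrix_mul_equiv, Matrix.blockDiagonal_conjTranspose, ← Matrix.blockDiagonal_mul]
    have h : (fun a => (V a : Matrix β β ℂ) * (V a : Matrix β β ℂ).conjTranspose)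
        = fun _ => 1 := by
      ext1 a
      exact Matrix.mem_unitaryGroup_iff.1 (V a).2
    rw [h]
    erw [Matrix.blockDiagonal_one]
    exact Matrix.submatrix_one_equiv e⟩

theorem conditionalUnitary_mulVec {B α β : Type*} [Fintype B] [DecidableEq B] [Fintype α]
    [DecidableEq α] [Fintype β] [DecidableEq β] (e : B ≃ β × α)
    (V : α → Matrix.unitaryGroup β ℂ) (f : B → ℂ) (b : B) :
    (conditionalUnitary e V : Matrix B B ℂ).mulVec f b
      = (V (e b).2 : Matrix β β ℂ).mulVec (fun j => f (e.symm (j, (e b).2))) (e b).1 := by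
  simp only [Matrix.mulVec, dotProduct, conditionalUnitary, Matrix.submatrix_apply,
    Matrix.blockDiagonal_apply]
  rw [← e.symm.sum_comp, Fintype.sum_prod_type]
  simp [ite_mul]

/-- The unitary that permutes the computational basis. -/
def permUnitary {B : Type*} [Fintype B] [DecidableEq B] (σ : Equiv.Perm B) :
    Matrix.unitaryGroup B ℂ :=
  ⟨σ.permMatrix ℂ, by
    rw [Matrix.mem_unitaryGroup_iff, Matrix.star_eq_conjTranspose, Matrix.conjTranspose_permMatrix,
      ← Matrix.permMatrix_mul]
    simp⟩

theorem permUnitary_mulVec {B : Type*} [Fintype B] [DecidableEq B] (σ : Equiv.Perm B) (f : B → ℂ) :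
    (permUnitary σ : Matrix B B ℂ).mulVec f = f ∘ σ :=
  Matrix.permMatrix_mulVec σ

theorem kronecker_reflectionAbout_mulVec {κ ω : Type*} [Fintype κ] [DecidableEq κ] [Fintype ω]
    [DecidableEq ω] (S : Finset (Fin N)) (f : κ × (Fin N × ω) → ℂ) (y : κ) (i : Fin N) (t : ω) :
    ((1 : Matrix κ κ ℂ) ⊗ₖ (reflectionAbout S ⊗ₖ (1 : Matrix ω ω ℂ))).mulVec f (y, (i, t))
      = (reflectionAbout S).mulVec (fun j => f (y, (j, t))) i := by
  simp only [Matrix.mulVec, dotProduct, Matrix.kroneckerMap_apply,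
    Fintype.sum_prod_type, Matrix.one_apply, ite_mul, mul_ite, mul_one, mul_zero, zero_mul, one_mul]
  simp

/-! ### The sampling and rotation algorithm -/

section algorithm

variable (N) in
/-- Basis labels for `r + 1` copies, the reflection register and a control register. -/
abbrev RotationBasis (r n : ℕ) : Type := (Fin (r + 1) → Fin N) × (Fin N × Fin (n + 1))

/-- Apply a unitary to the reflection register, conditioned on the other registers. -/
def mainUnitary {r n : ℕ}
    (V : (Fin (r + 1) → Fin N) × Fin (n + 1) → Matrix.unitaryGroup (Fin N) ℂ) :
    Matrix.unitaryGroup (RotationBasis N r n) ℂ :=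
  conditionalUnitary
    { toFun b := (b.2.1, (b.1, b.2.2))
      invFun c := (c.2.1, (c.1, c.2.2))
      left_inv _ := rfl
      right_inv _ := rfl } V

theorem mainUnitary_mulVec {r n : ℕ}
    (V : (Fin (r + 1) → Fin N) × Fin (n + 1) → Matrix.unitaryGroup (Fin N) ℂ)
    (f : RotationBasis N r n → ℂ) (y : Fin (r + 1) → Fin N) (i : Fin N) (t : Fin (n + 1)) :
    (mainUnitary V).1.mulVec f (y, (i, t))
      = (V (y, t) : Matrix (Fin N) (Fin N) ℂ).mulVec (fun i' => f (y, (i', t))) i :=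
  conditionalUnitary_mulVec _ _ _ _

/-- Apply a unitary to the control register. -/
def controlUnitary {r n : ℕ} (F : Matrix.unitaryGroup (Fin (n + 1)) ℂ) :
    Matrix.unitaryGroup (RotationBasis N r n) ℂ :=
  conditionalUnitary (β := Fin (n + 1)) (α := (Fin (r + 1) → Fin N) × Fin N)
    { toFun b := (b.2.2, (b.1, b.2.1))
      invFun c := (c.2.1, (c.2.2, c.1))
      left_inv _ := rfl
      right_inv _ := rfl } fun _ => F

theorem controlUnitary_mulVec {r n : ℕ} (F : Matrix.unitaryGroup (Fin (n + 1)) ℂ)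
    (f : RotationBasis N r n → ℂ) (y : Fin (r + 1) → Fin N) (i : Fin N) (t : Fin (n + 1)) :
    (controlUnitary (N := N) (r := r) F).1.mulVec f (y, (i, t))
      = (F : Matrix (Fin (n + 1)) (Fin (n + 1)) ℂ).mulVec (fun t' => f (y, (i, t'))) t :=
  conditionalUnitary_mulVec _ _ _ _

/-- Swap the reflection register with the first copy. -/
def swapFirstCopy (r n : ℕ) : Equiv.Perm (RotationBasis N r n) where
  toFun b := (Fin.cons b.2.1 (Fin.tail b.1), (b.1 0, b.2.2))
  invFun b := (Fin.cons b.2.1 (Fin.tail b.1), (b.1 0, b.2.2))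
  left_inv b := by simp
  right_inv b := by simp

variable {r n : ℕ} (F A : Matrix.unitaryGroup (Fin (n + 1)) ℂ)
  {P : (Fin r → Fin N) → Matrix (Fin N) (Fin N) ℂ} (hP : ∀ x, IsStarProjection (P x))

/-- The `j`-th unitary without the control preparation and the control measurement: for control
value `t`, reflect about `P x` in the last `t` rounds, where `x` are the sampled copies. -/
def delayedReflection (j : ℕ) : Matrix.unitaryGroup (RotationBasis N r n) ℂ :=
  mainUnitary fun a => if n < j + a.2 then reflectionOf (hP (Fin.tail a.1)) else 1

/-- Load a copy of `|S⟩` in the reflection register and the first column of `A` in the control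
register, apply a number of rotations given by the control register, measure the copies and
measure the control register in the basis given by `F`; accept the outcomes in `D`. -/
def rotationAlg (i₀ : Fin N) (D : (Fin r → Fin N) → Finset (Fin (n + 1))) :
    SampleReflectAlg N where
  copies := r + 1
  reflections := n
  work := Fin (n + 1)
  init := (i₀, 0)
  unitary j := (if j = n then controlUnitary F else 1) *
    (delayedReflection hP j *
      (if j = 0 then controlUnitary A * permUnitary (swapFirstCopy r n) else 1))
  accept := Finset.univ.filter fun b => b.2.2 ∈ D (Fin.tail b.1)

/-- The state of the rotation algorithm after `j` rounds, before the final control measurement. -/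
def rotationState (i₀ : Fin N) (S : Finset (Fin N)) (j : ℕ) : RotationBasis N r n → ℂ :=
  fun b => (if b.1 0 = i₀ then 1 else 0) * (∏ k, uniformKet S (Fin.tail b.1 k)) * (-1) ^ j *
    ((A : Matrix (Fin (n + 1)) (Fin (n + 1)) ℂ) b.2.2 0 *
      rotationOrbit (hP (Fin.tail b.1)) S (j + b.2.2 - n + 1) b.2.1)

theorem delayedReflection_mulVec_zero (f : RotationBasis N r n → ℂ) :
    (delayedReflection (n := n) hP 0).1.mulVec f
      = f := by
  ext b
  obtain ⟨y, i, t⟩ := b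
  rw [delayedReflection, mainUnitary_mulVec, if_neg (by simp; omega)]
  simp

theorem prepare_mulVec (i₀ : Fin N) {S : Finset (Fin N)} (hS : S.Nonempty) :
    (controlUnitary (N := N) (r := r) A).1.mulVec
      ((permUnitary (swapFirstCopy r n)).1.mulVec
          fun b => (∏ j, uniformKet S (b.1 j)) * if b.2 = (i₀, 0) then 1 else 0)
      = rotationState A hP i₀ S 0 := by
  ext b
  obtain ⟨y, i, t⟩ := b
  rw [controlUnitary_mulVec, permUnitary_mulVec]
  -- Truncated subtraction: since `t ≤ n`, every control value starts at index 1 of the orbit, which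
  -- is `|S⟩`.
  have ht : 0 + (t : ℕ) - n + 1 = 1 := by omega
  simp only [Function.comp_apply, swapFirstCopy, Equiv.coe_fn_mk, rotationState, ht,
    rotationOrbit_one (hP _) hS, Matrix.mulVec, dotProduct, Prod.mk.injEq]
  rw [Finset.sum_eq_single 0 (fun k _ hk => by simp [hk]) (by simp), Fin.prod_univ_succ]
  simp only [Fin.cons_zero, Fin.cons_succ, and_true, pow_zero, mul_one]
  ring

/-- The reflection about `|S⟩` cannot be switched off, but before a branch becomes active it only
maps `|S⟩` to `-|S⟩`. In an active round, the rotation carries its own minus sign. All branches thus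
acquire the same `(-1)^j`, and no controlled `R_S` is needed. -/
theorem delayedReflection_mulVec_rotationState (i₀ : Fin N) {S : Finset (Fin N)} (hS : S.Nonempty)
    (j : ℕ) :
    (delayedReflection (n := n) hP (j + 1)).1.mulVec
      (((1 : Matrix (Fin (r + 1) → Fin N) (Fin (r + 1) → Fin N) ℂ) ⊗ₖ
        (reflectionAbout S ⊗ₖ (1 : Matrix (Fin (n + 1)) (Fin (n + 1)) ℂ))).mulVec
          (rotationState A hP i₀ S j))
      = rotationState A hP i₀ S (j + 1) := by
  ext b
  obtain ⟨y, i, t⟩ := b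
  set c : ℂ := (if y 0 = i₀ then 1 else 0) * (∏ k, uniformKet S (Fin.tail y k)) * (-1) ^ j *
    (A : Matrix (Fin (n + 1)) (Fin (n + 1)) ℂ) t 0 with hc
  have hstate : (fun i' => rotationState A hP i₀ S j (y, (i', t)))
      = c • rotationOrbit (hP (Fin.tail y)) S (j + t - n + 1) := by
    ext i'
    simp only [rotationState, Pi.smul_apply, smul_eq_mul, hc]
    ring
  rw [delayedReflection, mainUnitary_mulVec]
  simp only [kronecker_reflectionAbout_mulVec]
  rw [hstate, Matrix.mulVec_smul]
  change Matrix.mulVec _ (c • _) i = _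
  rw [Matrix.mulVec_smul]
  simp only [rotationState, Pi.smul_apply, smul_eq_mul]
  by_cases hj : n < j + 1 + t
  · rw [if_pos hj, show j + 1 + (t : ℕ) - n + 1 = (j + t - n + 1) + 1 by omega]
    conv_rhs => rw [rotationOrbit]
    simp only [Pi.neg_apply, hc]
    ring
  · rw [if_neg hj, show j + (t : ℕ) - n + 1 = 1 by omega,
      show j + 1 + (t : ℕ) - n + 1 = 1 by omega, rotationOrbit_one _ hS,
      reflectionAbout_mulVec_uniformKet hS]
    simp only [OneMemClass.coe_one, Matrix.one_mulVec, Pi.neg_apply, hc]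
    ring

theorem rotationAlg_stateAfter (i₀ : Fin N) {S : Finset (Fin N)} (hS : S.Nonempty)
    (D : (Fin r → Fin N) → Finset (Fin (n + 1))) (j : ℕ) (hj : j ≤ n) :
    (rotationAlg F A hP i₀ D).stateAfter S j =
      (if j = n then controlUnitary F else 1 : Matrix.unitaryGroup (RotationBasis N r n) ℂ).1.mulVec
          (rotationState A hP i₀ S j) := by
  induction j with
  | zero =>
    rw [← prepare_mulVec A hP i₀ hS, 
      ← delayedReflection_mulVec_zero hP (Matrix.mulVec (controlUnitary A).1 _)]
    simp only [Matrix.mulVec_mulVec]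
    rfl
  | succ j ih =>
    have h1 : (rotationAlg F A hP i₀ D).stateAfter S j = rotationState A hP i₀ S j := by
      rw [ih (by omega), if_neg (by omega)]
      exact Matrix.one_mulVec _
    rw [← delayedReflection_mulVec_rotationState A hP i₀ hS, ← h1]
    conv_rhs => rw [Matrix.mulVec_mulVec]
    have h2 : (rotationAlg F A hP i₀ D).unitary (j + 1) = ((if j + 1 = n then controlUnitary F else 1)
        * delayedReflection hP (j + 1) : Matrix.unitaryGroup (RotationBasis N r n) ℂ) := by
      change _ * (_ * (if j + 1 = 0 then _ else 1)) = _
      rw [if_neg (Nat.succ_ne_zero j), mul_one]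
      rfl
    rw [SampleReflectAlg.stateAfter, h2]
    rfl

/-- Deferred measurement: after the swap, the remaining `r` copies serve only as controls, so the
result is a classical average over independent uniform samples `x` from `S`. -/
theorem rotationAlg_acceptProb (i₀ : Fin N) {S : Finset (Fin N)} (hS : S.Nonempty)
    (D : (Fin r → Fin N) → Finset (Fin (n + 1))) :
    (rotationAlg F A hP i₀ D).acceptProb S =
      ∑ x : Fin r → Fin N, (∏ k, ‖uniformKet S (x k)‖ ^ 2) * ∑ k ∈ D x, ∑ i,
        ‖(F : Matrix (Fin (n + 1)) (Fin (n + 1)) ℂ).mulVec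
          (fun t => (A : Matrix (Fin (n + 1)) (Fin (n + 1)) ℂ) t 0 *
            rotationOrbit (hP x) S (t + 1) i) k‖ ^ 2 := by
  have hst : ∀ (y : Fin (r + 1) → Fin N) (i : Fin N) (k : Fin (n + 1)),
      ‖(rotationAlg F A hP i₀ D).stateAfter S n (y, (i, k))‖ ^ 2 =
        (if y 0 = i₀ then 1 else 0) * ((∏ k, ‖uniformKet S (Fin.tail y k)‖ ^ 2) *
          ‖(F : Matrix (Fin (n + 1)) (Fin (n + 1)) ℂ).mulVec
            (fun t => (A : Matrix (Fin (n + 1)) (Fin (n + 1)) ℂ) t 0 *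
              rotationOrbit (hP (Fin.tail y)) S (t + 1) i) k‖ ^ 2) := by
    intro y i k
    set c : ℂ := (if y 0 = i₀ then 1 else 0) * (∏ k, uniformKet S (Fin.tail y k)) * (-1) ^ n
      with hc
    have hstate : (fun t' => rotationState A hP i₀ S n (y, (i, t')))
        = c • fun t => (A : Matrix (Fin (n + 1)) (Fin (n + 1)) ℂ) t 0 *
            rotationOrbit (hP (Fin.tail y)) S (t + 1) i := by
      ext t
      simp only [rotationState, Pi.smul_apply, smul_eq_mul, hc, Nat.add_sub_cancel_left]
    have hfinal : (rotationAlg F A hP i₀ D).stateAfter S n (y, (i, k)) =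
        (F : Matrix (Fin (n + 1)) (Fin (n + 1)) ℂ).mulVec
          (fun t' => rotationState A hP i₀ S n (y, (i, t'))) k := by
      refine (congrFun (rotationAlg_stateAfter F A hP i₀ hS D n le_rfl) (y, (i, k))).trans ?_
      rw [if_pos rfl]
      exact controlUnitary_mulVec _ _ _ _ _
    rw [hfinal, hstate, Matrix.mulVec_smul, Pi.smul_apply, smul_eq_mul, norm_mul, mul_pow,
      ← mul_assoc, hc]
    congr 1
    rw [norm_mul, norm_mul, norm_prod, mul_pow, mul_pow, Finset.prod_pow]
    split_ifs <;> simp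
  have h1 : (rotationAlg F A hP i₀ D).acceptProb S =
      ∑ y : Fin (r + 1) → Fin N, ∑ i, ∑ k, if k ∈ D (Fin.tail y) then
        ‖(rotationAlg F A hP i₀ D).stateAfter S n (y, (i, k))‖ ^ 2 else 0 := by
    refine (Finset.sum_filter _ _).trans ?_
    refine (Fintype.sum_prod_type _).trans ?_
    refine Finset.sum_congr rfl fun y _ => ?_
    exact Fintype.sum_prod_type _
  rw [h1]
  simp only [hst]
  rw [← (Fin.consEquiv fun _ => Fin N).sum_comp, Fintype.sum_prod_type]
  simp only [Fin.consEquiv, Equiv.coe_fn_mk, Fin.cons_zero, Fin.tail_cons]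
  rw [Finset.sum_eq_single i₀ (fun j _ hj => by simp [hj]) (by simp)]
  refine Finset.sum_congr rfl fun x _ => ?_
  simp only [if_true, one_mul]
  rw [Finset.sum_comm, Finset.mul_sum, ← Finset.sum_subset (Finset.subset_univ (D x))
    fun k _ hk => by simp [hk]]
  refine Finset.sum_congr rfl fun k hk => ?_
  simp [hk, Finset.mul_sum]

end algorithm

/-! ### The two algorithms -/

/-- The algorithm that rejects without using any resource. -/
theorem SampleReflectAlg.exists_solves_of_lt (hN : 1 ≤ N) {w : ℕ} (hw : N < 2 * w) {ε : ℝ}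
    (hε : 0 ≤ ε) :
    ∃ Q : SampleReflectAlg N, Q.copies + Q.reflections = 0 ∧ Q.SolvesApxCount w ε := by
  refine ⟨{ copies := 0, reflections := 0, work := Unit, init := (⟨0, hN⟩, ()),
            unitary := fun _ => 1, accept := ∅ }, rfl, fun S _ => ⟨fun h => ?_, fun _ => ?_⟩⟩
  · have := S.card_le_univ
    rw [Fintype.card_fin] at this
    omega
  · simpa [SampleReflectAlg.acceptProb] using hε

theorem sum_prod_norm_sq_uniformKet {S : Finset (Fin N)} (hS : S.Nonempty) (r : ℕ) :
    ∑ x : Fin r → Fin N, ∏ k, ‖uniformKet S (x k)‖ ^ 2 = 1 := by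
  rw [← Fintype.piFinset_univ, 
    ← Finset.prod_univ_sum (fun _ => Finset.univ) fun _ i => ‖uniformKet S i‖ ^ 2]
  simp [sum_norm_sq_uniformKet hS]

theorem sum_sum_norm_sq_eq_one {ι κ : Type*} [Fintype ι] [Fintype κ] [DecidableEq ι]
    (F : Matrix.unitaryGroup ι ℂ) (a : ι → ℂ) (ha : ∑ t, ‖a t‖ ^ 2 = 1) (w : ι → κ → ℂ)
    (hw : ∀ t, ∑ i, ‖w t i‖ ^ 2 = 1) :
    ∑ k, ∑ i, ‖(F : Matrix ι ι ℂ).mulVec (fun t => a t * w t i) k‖ ^ 2 = 1 := by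
  rw [Finset.sum_comm]
  simp only [Matrix.unitaryGroup.sum_norm_sq_mulVec]
  rw [Finset.sum_comm, ← ha]
  refine Finset.sum_congr rfl fun t _ => ?_
  simp only [norm_mul, mul_pow, ← Finset.mul_sum, hw, mul_one]

/-- A sequence of independent uniform samples has a repetition with small probability. -/
theorem sum_not_injective_le {S : Finset (Fin N)} (hS : S.Nonempty) (r : ℕ) :
    ∑ x : Fin r → Fin N with ¬ Function.Injective x, ∏ k, ‖uniformKet S (x k)‖ ^ 2
      ≤ (r : ℝ) * (r - 1) / S.card := by
  classical
  have hs : (0 : ℝ) < S.card := by exact_mod_cast hS.card_pos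
  have htot := sum_prod_norm_sq_uniformKet hS r
  rw [← Finset.sum_filter_add_sum_filter_not _ Function.Injective] at htot
  have hr1 : 0 ≤ (r : ℝ) * (r - 1) := by
    rcases r with _ | r
    · simp
    · push_cast; ring_nf; positivity
  have hinj : ((S.card.descFactorial r : ℕ) : ℝ) * (1 / (S.card : ℝ)) ^ r ≤
      ∑ x : Fin r → Fin N with Function.Injective x, ∏ k, ‖uniformKet S (x k)‖ ^ 2 := by
    have hc : Fintype.card (Fin r ↪ S) = S.card.descFactorial r := by
      rw [Fintype.card_embedding_eq, Fintype.card_coe, Fintype.card_fin]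
    let g : (Fin r ↪ S) → (Fin r → Fin N) := fun e k => (e k : Fin N)
    have hg : Function.Injective g := by
      intro e e' h
      ext k
      exact congrArg Fin.val (congrFun h k)
    calc _ = ∑ e : Fin r ↪ S, ∏ k, ‖uniformKet S (g e k)‖ ^ 2 := by
          simp [norm_sq_uniformKet, g, hc]
      _ = ∑ x ∈ Finset.univ.map ⟨g, hg⟩, ∏ k, ‖uniformKet S (x k)‖ ^ 2 := by
          rw [Finset.sum_map]
          rfl
      _ ≤ _ := by
          refine Finset.sum_le_sum_of_subset_of_nonneg ?_ fun _ _ _ =>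
            Finset.prod_nonneg fun _ _ => by positivity
          intro x hx
          obtain ⟨e, -, rfl⟩ := Finset.mem_map.1 hx
          exact Finset.mem_filter.2 ⟨Finset.mem_univ _, Subtype.val_injective.comp e.injective⟩
  have hdesc : 1 - (r : ℝ) * (r - 1) / S.card ≤
      ((S.card.descFactorial r : ℕ) : ℝ) * (1 / (S.card : ℝ)) ^ r := by
    -- For `r ≤ |S|`, each of the `r` factors of the falling factorial is at least `|S| + 1 - r`,
    -- and Bernoulli's inequality finishes. For `r > |S|` the left side is nonpositive.
    rcases le_or_gt r S.card with hle | hgt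
    · have h1 : ((S.card + 1 - r : ℕ) : ℝ) ^ r ≤ ((S.card.descFactorial r : ℕ) : ℝ) := by
        exact_mod_cast Nat.pow_sub_le_descFactorial _ _
      rw [Nat.cast_sub (by omega)] at h1
      push_cast at h1
      have hle' : (r : ℝ) ≤ S.card := by exact_mod_cast hle
      have h2 : (-2 : ℝ) ≤ -((r - 1) / S.card) := by
        rw [neg_le_neg_iff, div_le_iff₀ hs]; linarith
      have h3 := one_add_mul_le_pow h2 r
      calc 1 - (r : ℝ) * (r - 1) / S.card = 1 + r * -((r - 1) / S.card) := by ring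
        _ ≤ (1 + -((r - 1) / S.card)) ^ r := h3
        _ = ((S.card : ℝ) + 1 - r) ^ r * (1 / (S.card : ℝ)) ^ r := by
            rw [← mul_pow]; congr 1; field_simp; ring
        _ ≤ _ := by gcongr
    · have h1 : (S.card : ℝ) + 1 ≤ r := by exact_mod_cast hgt
      have h2 : 1 ≤ (r : ℝ) * (r - 1) / S.card := by rw [le_div_iff₀ hs]; nlinarith
      have : 0 ≤ ((S.card.descFactorial r : ℕ) : ℝ) * (1 / (S.card : ℝ)) ^ r := by positivity
      linarith
  linarith

theorem isStarProjection_diagonal_indicator {ι : Type*} [Fintype ι] [DecidableEq ι]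
    (T : Finset ι) :
    IsStarProjection (Matrix.diagonal fun i => if i ∈ T then (1 : ℂ) else 0) := by
  refine ⟨?_, ?_⟩
  · rw [IsIdempotentElem, Matrix.diagonal_mul_diagonal]
    simp
  · rw [IsSelfAdjoint, Matrix.star_eq_conjTranspose, Matrix.diagonal_conjTranspose]
    congr 1
    ext i
    simp only [Pi.star_apply]
    split_ifs <;> simp

theorem uniformKet_mul_self (S : Finset (Fin N)) (i : Fin N) :
    uniformKet S i * uniformKet S i = if i ∈ S then ((1 / S.card : ℝ) : ℂ) else 0 := by
  unfold uniformKet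
  split_ifs
  · rw [← Complex.ofReal_mul, div_mul_div_comm, Real.mul_self_sqrt (by positivity), one_mul]
  · simp

theorem dotProduct_uniformKet_univ {S : Finset (Fin N)} (hS : S.Nonempty) :
    dotProduct (uniformKet S) ((Matrix.vecMulVec (uniformKet (Finset.univ : Finset (Fin N)))
      (star (uniformKet Finset.univ))).mulVec (uniformKet S)) = ((S.card / N : ℝ) : ℂ) := by
  have h : dotProduct (uniformKet (Finset.univ : Finset (Fin N))) (uniformKet S) =
      ((√S.card / √N : ℝ) : ℂ) := by
    simp only [dotProduct, uniformKet, Finset.mem_univ, if_true, mul_ite, mul_zero,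
      Finset.sum_ite_mem, Finset.univ_inter, Finset.sum_const, Finset.card_univ, Fintype.card_fin,
      nsmul_eq_mul]
    have hs : (0 : ℝ) < √S.card := Real.sqrt_pos.2 (by exact_mod_cast hS.card_pos)
    rw [← Complex.ofReal_mul, ← Complex.ofReal_natCast, ← Complex.ofReal_mul]
    congr 1
    rw [← Real.mul_self_sqrt (Nat.cast_nonneg S.card)]
    field_simp
    rw [Real.sqrt_sq hs.le]
  rw [Matrix.vecMulVec_mulVec, star_uniformKet, dotProduct_smul,
    dotProduct_comm (uniformKet S), h, op_smul_eq_smul, smul_eq_mul, ← Complex.ofReal_mul,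
    div_mul_div_comm, Real.mul_self_sqrt (by positivity), Real.mul_self_sqrt (by positivity)]

theorem dotProduct_uniformKet_diagonal {S T : Finset (Fin N)} (hT : T ⊆ S) :
    dotProduct (uniformKet S)
      ((Matrix.diagonal fun i => if i ∈ T then (1 : ℂ) else 0).mulVec (uniformKet S))
      = ((T.card / S.card : ℝ) : ℂ) := by
  simp only [dotProduct, Matrix.mulVec_diagonal, ite_mul, one_mul, zero_mul, mul_ite, mul_zero,
    Finset.sum_ite_mem, Finset.univ_inter, uniformKet_mul_self]
  rw [Finset.inter_eq_left.2 hT]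
  simp
  ring

/-- Amplitude estimation of the overlap of `|S⟩` with the uniform superposition over `[N]`. -/
theorem exists_solves_amplitude_estimation (ε : ℝ) (hε : 0 < ε) :
    ∃ C : ℝ, 0 < C ∧ ∀ N w : ℕ, 1 ≤ w → 2 * w ≤ N → ∃ Q : SampleReflectAlg N,
      ((Q.copies + Q.reflections : ℕ) : ℝ) ≤ C * √((N : ℝ) / w) ∧ Q.SolvesApxCount w ε := by
  obtain ⟨K, hK, hdisc⟩ := exists_phase_discriminator ε hε
  refine ⟨K + 1, by positivity, fun N w hw hN => ?_⟩
  have hw' : (0 : ℝ) < w := by exact_mod_cast hw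
  have hN' : (2 : ℝ) * w ≤ N := by exact_mod_cast hN
  have hN0 : (0 : ℝ) < N := by linarith
  obtain ⟨n, hn, F, a, G, ha, hG⟩ := hdisc (w / N) (by positivity)
    ((div_le_one hN0).2 (by linarith))
  obtain ⟨A, hA⟩ := Matrix.unitaryGroup.exists_col_eq 0 a ha
  have hne : (Finset.univ : Finset (Fin N)).Nonempty := ⟨⟨0, by omega⟩, Finset.mem_univ _⟩
  -- No samples are used here: the only copy of `|S⟩` is the starting vector of the orbit. Large
  -- sets have large overlap, so acceptance is on `Gᶜ`.
  have hP : ∀ _ : Fin 0 → Fin N, IsStarProjection _ := fun _ => isStarProjection_uniformKet hne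
  refine ⟨rotationAlg F A hP ⟨0, by omega⟩ fun _ => Gᶜ, ?_, fun S hS => ?_⟩
  · have h1 : 1 ≤ √((N : ℝ) / w) := by
      rw [Real.one_le_sqrt, le_div_iff₀ hw']; linarith
    have h2 : K / √((w : ℝ) / N) = K * √((N : ℝ) / w) := by
      rw [div_eq_mul_inv, ← Real.sqrt_inv, inv_div]
    simp only [rotationAlg]
    push_cast
    linarith
  have hcard : (S.card : ℝ) ≤ N := by
    have := S.card_le_univ
    rw [Fintype.card_fin] at this
    exact_mod_cast this
  have hprob := rotationAlg_acceptProb F A hP ⟨0, by omega⟩ hS fun _ => Gᶜ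
  simp only [hA, Fintype.sum_unique, Finset.univ_eq_empty, Finset.prod_empty, one_mul] at hprob
  rw [hprob]
  set W := rotationOrbit (hP default) S with hW
  have hW1 : ∀ s, ∑ i, ‖W s i‖ ^ 2 = 1 := sum_norm_sq_rotationOrbit _ hS
  have hsum := sum_sum_norm_sq_eq_one F a ha (fun t => W (t + 1)) fun t => hW1 _
  rw [← Finset.sum_add_sum_compl G] at hsum
  obtain ⟨hlow, hhigh⟩ := hG W (S.card / N) (by positivity) ((div_le_one hN0).2 hcard) hW1
    fun s i => congrFun (rotationOrbit_recurrence _ hS (dotProduct_uniformKet_univ hS) s) i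
  refine ⟨fun h => ?_, fun h => hlow ?_⟩
  · have h' : (2 : ℝ) * w ≤ S.card := by exact_mod_cast h
    have := hhigh (by rw [← mul_div_assoc]; gcongr)
    linarith
  · gcongr

/-- Sample a few elements of `S` and estimate the weight of `|S⟩` on the set of samples. -/
theorem exists_solves_sampling (ε : ℝ) (hε : 0 < ε) :
    ∃ C : ℝ, 0 < C ∧ ∀ N w : ℕ, 1 ≤ w → 2 * w ≤ N → ∃ Q : SampleReflectAlg N,
      ((Q.copies + Q.reflections : ℕ) : ℝ) ≤ C * (w : ℝ) ^ (1 / 3 : ℝ) ∧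
        Q.SolvesApxCount w ε := by
  classical
  obtain ⟨K, hK, hdisc⟩ := exists_phase_discriminator (ε / 2) (by positivity)
  -- The bound `c ≤ ε/4` keeps the repetition probability at most `ε/2`; `c ≤ 1` gives `r ≤ w` and
  -- the bound on the number of copies.
  obtain ⟨c, hc0, hc1, hcε⟩ : ∃ c : ℝ, 0 < c ∧ c ≤ 1 ∧ c ≤ ε / 4 :=
    ⟨min 1 (ε / 4), by positivity, min_le_left _ _, min_le_right _ _⟩
  refine ⟨3 + K * √(2 / c), by positivity, fun N w hw hN => ?_⟩
  have hw1 : (1 : ℝ) ≤ w := by exact_mod_cast hw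
  set z : ℝ := (w : ℝ) ^ (1 / 3 : ℝ) with hz
  have hz1 : 1 ≤ z := Real.one_le_rpow hw1 (by norm_num)
  have hz3 : z ^ 3 = w := by
    rw [hz, ← Real.rpow_natCast, ← Real.rpow_mul (by positivity)]
    norm_num
  set r := ⌈c * z⌉₊ with hr
  have hrge : c * z ≤ r := Nat.le_ceil _
  have hrlt : (r : ℝ) < c * z + 1 := Nat.ceil_lt_add_one (by positivity)
  have hr0 : (0 : ℝ) < r := lt_of_lt_of_le (by positivity) hrge
  have hrw : (r : ℝ) ≤ w := by
    have : r ≤ w := Nat.ceil_le.2 (by rw [← hz3]; nlinarith [le_self_pow₀ hz1 (three_ne_zero)])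
    exact_mod_cast this
  have hcoll : (r : ℝ) * (r - 1) ≤ ε / 2 * (2 * w) := by
    have h1 : (r : ℝ) * (r - 1) ≤ (c * z + 1) * (c * z) := by
      rcases le_or_gt 1 (r : ℝ) with h | h
      · apply mul_le_mul <;> linarith
      · have : 0 ≤ (c * z + 1) * (c * z) := by positivity
        nlinarith
    have h2 : (c * z + 1) * (c * z) ≤ 2 * z * (c * z) := by
      gcongr
      nlinarith
    have h3 : 2 * z * (c * z) ≤ 2 * (ε / 4) * z ^ 2 := by
      have : 2 * z * (c * z) = 2 * c * z ^ 2 := by ring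
      rw [this]
      gcongr
    have h4 : 2 * (ε / 4) * z ^ 2 ≤ 2 * (ε / 4) * z ^ 3 := by
      gcongr
      norm_num
    rw [hz3] at h4
    nlinarith
  obtain ⟨n, hn, F, a, G, ha, hG⟩ := hdisc (r / (2 * w)) (by positivity)
    ((div_le_one (by positivity)).2 (by linarith))
  obtain ⟨A, hA⟩ := Matrix.unitaryGroup.exists_col_eq 0 a ha
  have hP : ∀ x : Fin r → Fin N, IsStarProjection _ := fun x =>
    isStarProjection_diagonal_indicator (Finset.univ.image x)
  -- Repeated samples lead to rejection, which is harmless for small sets; repetitions must be rare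
  -- only when `|S| ≥ 2w`. Here a large set means a small overlap, so acceptance is on `G`.
  set D : (Fin r → Fin N) → Finset (Fin (n + 1)) :=
    fun x => if Function.Injective x then G else ∅ with hD
  refine ⟨rotationAlg F A hP ⟨0, by omega⟩ D, ?_, fun S hS => ?_⟩
  -- As `r ≥ cz` and `w = z³`, one has `2w/r ≤ (2/c) z²`. The `r + 1 ≤ cz + 2` copies account for
  -- the `3` in the constant.
  · have h2 : K / √((r : ℝ) / (2 * w)) ≤ K * (√(2 / c) * z) := by
      rw [div_eq_mul_inv, ← Real.sqrt_inv, inv_div]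
      gcongr
      rw [← Real.sqrt_sq (show 0 ≤ z by positivity), ← Real.sqrt_mul (by positivity)]
      apply Real.sqrt_le_sqrt
      rw [div_mul_eq_mul_div, div_le_div_iff₀ hr0 hc0, ← hz3]
      calc 2 * z ^ 3 * c = 2 * z ^ 2 * (c * z) := by ring
        _ ≤ _ := by gcongr
    simp only [rotationAlg]
    push_cast
    nlinarith
  have hs0 : (0 : ℝ) < S.card := by exact_mod_cast hS.card_pos
  rw [rotationAlg_acceptProb]
  swap
  · exact hS
  simp only [hA]
  set g : (Fin r → Fin N) → ℝ := fun x => ∏ k, ‖uniformKet S (x k)‖ ^ 2 with hg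
  have hg0 : ∀ x, 0 ≤ g x := fun x => Finset.prod_nonneg fun _ _ => by positivity
  have hgsum : ∑ x, g x = 1 := sum_prod_norm_sq_uniformKet hS r
  set q : (Fin r → Fin N) → Finset (Fin (n + 1)) → ℝ := fun x H => ∑ k ∈ H, ∑ i,
    ‖(F : Matrix _ _ ℂ).mulVec (fun t => a t * rotationOrbit (hP x) S (t + 1) i) k‖ ^ 2 with hq
  change (_ → _ ≤ ∑ x, g x * q x (D x)) ∧ (_ → ∑ x, g x * q x (D x) ≤ _)
  have hW1 : ∀ x s, ∑ i, ‖rotationOrbit (hP x) S s i‖ ^ 2 = 1 :=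
    fun x => sum_norm_sq_rotationOrbit _ hS
  have hqsum : ∀ x, q x G + q x Gᶜ = 1 := fun x => by
    rw [hq, ← sum_sum_norm_sq_eq_one F a ha (fun t => rotationOrbit (hP x) S (t + 1))
      fun t => hW1 x _]
    exact Finset.sum_add_sum_compl _ _
  have hmem : ∀ x, g x ≠ 0 → ∀ k, x k ∈ S := by
    intro x hx k
    by_contra hk
    exact hx (Finset.prod_eq_zero (Finset.mem_univ k) (by simp [norm_sq_uniformKet, hk]))
  have hcore : ∀ x, Function.Injective x → (∀ k, x k ∈ S) →
      (2 * w ≤ S.card → q x Gᶜ ≤ ε / 2) ∧ (S.card ≤ w → q x G ≤ ε / 2) := by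
    intro x hx hxS
    have hsub : Finset.univ.image x ⊆ S := by
      intro i hi
      obtain ⟨k, -, rfl⟩ := Finset.mem_image.1 hi
      exact hxS k
    have hTr : (Finset.univ.image x).card = r := by
      rw [Finset.card_image_of_injective _ hx, Finset.card_univ, Fintype.card_fin]
    have hrs : (r : ℝ) ≤ S.card := by exact_mod_cast hTr ▸ Finset.card_le_card hsub
    have hdot := dotProduct_uniformKet_diagonal hsub
    rw [hTr] at hdot
    obtain ⟨hlow, hhigh⟩ := hG (rotationOrbit (hP x) S) (r / S.card) (by positivity)
      ((div_le_one hs0).2 hrs) (hW1 x)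
      fun s i => congrFun (rotationOrbit_recurrence _ hS hdot s) i
    refine ⟨fun h => hlow ?_, fun h => hhigh ?_⟩
    · have h' : (2 : ℝ) * w ≤ S.card := by exact_mod_cast h
      gcongr
    · have h' : (S.card : ℝ) ≤ w := by exact_mod_cast h
      rw [← mul_div_assoc, mul_div_mul_left _ _ two_ne_zero]
      gcongr
  have hqempty : ∀ x, q x ∅ = 0 := fun x => Finset.sum_empty
  constructor
  · intro h
    have h' : (2 : ℝ) * w ≤ S.card := by exact_mod_cast h
    have hpt : ∀ x, g x * (1 - ε / 2) - (if ¬ Function.Injective x then g x else 0)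
        ≤ g x * q x (D x) := by
      intro x
      rcases eq_or_ne (g x) 0 with h0 | h0
      · simp [h0]
      by_cases hx : Function.Injective x
      · rw [if_neg (not_not.2 hx), sub_zero, hD]
        simp only [if_pos hx]
        have := (hcore x hx (hmem x h0)).1 h
        have := hqsum x
        exact mul_le_mul_of_nonneg_left (by linarith) (hg0 x)
      · rw [if_pos hx, hD]
        simp only [if_neg hx, hqempty]
        nlinarith [hg0 x]
    have hsum := Finset.sum_le_sum fun x (_ : x ∈ Finset.univ) => hpt x
    rw [Finset.sum_sub_distrib, ← Finset.sum_mul, hgsum, ← Finset.sum_filter] at hsum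
    have hni := sum_not_injective_le hS r
    have : (r : ℝ) * (r - 1) / S.card ≤ ε / 2 := by
      rw [div_le_iff₀ hs0]
      exact hcoll.trans (by gcongr)
    linarith
  · intro h
    have hpt : ∀ x, g x * q x (D x) ≤ g x * (ε / 2) := by
      intro x
      rcases eq_or_ne (g x) 0 with h0 | h0
      · simp [h0]
      refine mul_le_mul_of_nonneg_left ?_ (hg0 x)
      by_cases hx : Function.Injective x
      · rw [hD]
        simp only [if_pos hx]
        exact (hcore x hx (hmem x h0)).2 h
      · rw [hD]
        simp only [if_neg hx, hqempty]
        positivity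
    have hsum := Finset.sum_le_sum fun x (_ : x ∈ Finset.univ) => hpt x
    rw [← Finset.sum_mul, hgsum] at hsum
    linarith

end

theorem theorem1p4 :
    ∀ ε : ℝ, 0 < ε →
      ∃ C : ℝ, 0 < C ∧
        ∀ N w : ℕ, 1 ≤ N → 1 ≤ w →
          ∃ Q : SampleReflectAlg N,
            ((Q.copies + Q.reflections : ℕ) : ℝ)
                ≤ C * min ((w : ℝ) ^ (1 / 3 : ℝ)) (Real.sqrt ((N : ℝ) / (w : ℝ))) ∧
              Q.SolvesApxCount w ε := by
  intro ε hε
  obtain ⟨C₁, hC₁, h₁⟩ := exists_solves_sampling ε hε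
  obtain ⟨C₂, hC₂, h₂⟩ := exists_solves_amplitude_estimation ε hε
  refine ⟨max C₁ C₂, by positivity, fun N w hN hw => ?_⟩
  rcases lt_or_ge N (2 * w) with hlt | hge
  -- Since `√(N/w)` can be arbitrarily small in this range, an algorithm of cost exactly zero is
  -- needed.
  · obtain ⟨Q, hQ, hsol⟩ := SampleReflectAlg.exists_solves_of_lt hN hlt hε.le
    refine ⟨Q, ?_, hsol⟩
    rw [hQ, Nat.cast_zero]
    positivity
  rcases min_choice ((w : ℝ) ^ (1 / 3 : ℝ)) (Real.sqrt ((N : ℝ) / (w : ℝ))) with hmin | hmin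
  · obtain ⟨Q, hQ, hsol⟩ := h₁ N w hw hge
    refine ⟨Q, hQ.trans ?_, hsol⟩
    rw [hmin]
    gcongr
    exact le_max_left _ _
  · obtain ⟨Q, hQ, hsol⟩ := h₂ N w hw hge
    refine ⟨Q, hQ.trans ?_, hsol⟩
    rw [hmin]
    gcongr
    exact le_max_right _ _
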